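/- **Conventions.** In each calculus an expression is a pair $a<b$ of formulas, and a calculus is consistent if $\top<\bot$ is not a theorem of it. $A(x)$ denotes an expression and $A(c)$ the result of replacing the free variable $x$ by the closed term $c$. Let $R$ be any family (possibly empty) of finitary relations on the positive integers, such as $\alpha+\beta=\gamma$, $\alpha\cdot\beta=\gamma$. **$Z_0$.** Numbers are $1,\,1+1,\dots$; formulas are $\top$, $\bot$, $\alpha>\beta$ and the formulas $R_i(\alpha_1,\dots,\alpha_k)$, for numbers $\alpha,\beta,\alpha_j$. Theorems are generated by: (T1) $a<b$ if "if $a$ then $b$" is true; (T2) $a<a$, $\bot<a<\top$; (T3) $a<c,\ c<b\Rightarrow a<b$. **$K_0$.** Number variables are added (also inside the atomic formulas), and formulas are closed under $\wedge,\vee,\neg,\forall_x,\exists_x$. Added rules: (T4) $a<b_1,\ a<b_2\Leftrightarrow a<b_1\wedge b_2$; (T5) $a_1<b,\ a_2<b\Leftrightarrow a_1\vee a_2<b$; (T6) $a\wedge c<b\Rightarrow a<b\vee\neg c$; (T7) $a<b\vee c\Rightarrow a\wedge\neg c<b$; (T8) $a<b(x)\Leftrightarrow a<\forall_x b(x)$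 ($x$ not free in $a$); (T9) $a(x)<b\Leftrightarrow \exists_x a(x)<b$ ($x$ not free in $b$); (T10) ($A(\alpha)$ for each number $\alpha$) $\Leftrightarrow A(x)$. **$K_0'$.** The expressions are those of $K_0$ without free variables; the theorems are generated by (T1)–(T7) and, instead of (T8)–(T10), ($a<b(\gamma)$ for each number $\gamma$) $\Leftrightarrow a<\forall_x b(x)$ and ($a(\gamma)<b$ for each number $\gamma$) $\Leftrightarrow\exists_x a(x)<b$. **Lattices.** Lattices are preordered sets. A countably complete boolean lattice is a distributive lattice in which each element has a complement and each countable subset has a meet and a join. It is *over* a bounded preordered set $M$ if $M$ is embedded in it with its preorder and its zero and unit. It is *minimal* over $M$ if no proper subset contains $M$ and is closed under complements and countable meets and joins. It is *free* over $M$ if it is minimal over $M$ and each minimal countably complete boolean lattice over $M$ is an image of it under a homomorphism (respecting complements and countable meets and joins) that fixes $M$ up to equivalence. **Ramified sets.** Types are $0$ (numbers, order $0$) and $\nu(\tau_1\dots\tau_k)$ (order $\nu$), $k\ge1$, where the $\tau_j$ are types of order $<\nu$. Let $S$ be a set of types that contains $0$ and, with each type, its argument types; for example $S=\{0\}\cup\{\nu(0):\nu\ge1\}$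 (sets of numbers), or the set of all types. Put $K_0(S)=K_0$. * $Z_{n+1}(S)$ arises from $K_n(S)$ by adding, for each formula $a(x_1,\dots,x_k)$ of $K_n(S)$ and variables $x_j$ of types $\tau_j$, pairwise distinct, with $(n+1)(\tau_1\dots\tau_k)\in S$, the set $A=\hat x_1\dots\hat x_k\,a$ of this type; the formulas $(s_1,\dots,s_k)\in A$ for terms $s_j$ of $K_n(S)$ of type $\tau_j$; the theorems $a(x_1,\dots,x_k)<(x_1,\dots,x_k)\in A$ and $(x_1,\dots,x_k)\in A<a(x_1,\dots,x_k)$; and (T2), (T3), (T10) (for all kinds of variables present) also for the new formulas. * $K_{n+1}(S)$ arises from $Z_{n+1}(S)$ by adding free and bound variables $X$ of the types of order $n+1$ in $S$, closing the formulas under membership, $\wedge,\vee,\neg$ and all quantifiers, extending (T1)–(T10) to the new formulas, and adding (T8), (T9) for the variables $X$, and the rule ($A(C)$ for each closed set $C$ of the type of $X$) $\Leftrightarrow A(X)$. * $K(S)$ is the calculus defined in the same way with all types in $S$ at once; with $S$ the set of all types it is ramified type logic including arithmetic. **Theorem.** 1. $Z_0$ is consistent. 2. For formulas $a,b$ of $K_0$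 without free variables, $a<b$ is a theorem of $K_0'$ if and only if it is a theorem of $K_0$; for formulas $a,b$ of $Z_0$, $a<b$ is a theorem of $Z_0$ if and only if it is a theorem of $K_0'$. 3. The free countably complete boolean lattice over $Z_0$ exists, and $K_0'$ is contained isomorphically in it: for every free countably complete boolean lattice $V$ over $Z_0$ there is a map $f$ from the formulas of $K_0'$ to $V$, equal up to equivalence to the given embedding on $Z_0$, such that $a<b$ is a theorem of $K_0'$ if and only if $f(a)\le f(b)$, and such that $f$ takes $\wedge,\vee,\neg$ to meet, join, complement, and $\forall_x b(x)$, $\exists_x b(x)$ to the meet and the join of $\{f(b(\gamma)):\gamma \text{ a number}\}$. 4. $K_0'$ and $K_0$ are consistent. 5. For every $S$ as above and every $n\ge0$, the calculi $Z_{n+1}(S)$ and $K_{n+1}(S)$ are consistent, and so is $K(S)$. In particular, ramified type logic including arithmetic is consistent. -/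

import Mathlib

universe u

namespace Ramified

/-! ### Countably complete boolean lattices over a preordered set

Lattices are preordered: meets and joins are determined only up to mutual `≤`. -/

/-- `d` is a complement of `c`: `c ∧ d` is below everything, `c ∨ d` is above everything. -/
def Complementary {V : Type*} [Preorder V] (c d : V) : Prop :=
  (∀ x, x ≤ c → x ≤ d → IsBot x) ∧ (∀ x, c ≤ x → d ≤ x → IsTop x)

/-- Countably complete boolean lattice. Binary meets and joins, zero and unit are the meets and
joins of pairs and of the empty set. -/
structure IsCCBooleanLattice (V : Type*) [Preorder V] : Prop where
  exists_isGLB : ∀ s : Set V, s.Countable → ∃ c, IsGLB s c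
  exists_isLUB : ∀ s : Set V, s.Countable → ∃ c, IsLUB s c
  distrib : ∀ a b c m j : V, IsGLB {a, c} m → IsLUB {b, c} j → m ≤ b → a ≤ j → a ≤ b
  exists_compl : ∀ c : V, ∃ d, Complementary c d

/-- The set `M` with the relation `r` is, via `ι`, a part of `V`, with the same zero and unit. -/
structure IsPart {M V : Type*} [Preorder V] (r : M → M → Prop) (ι : M → V) : Prop where
  le_iff : ∀ a b, r a b ↔ ι a ≤ ι b
  isBot : ∀ z, (∀ a, r z a) → IsBot (ι z)
  isTop : ∀ e, (∀ a, r a e) → IsTop (ι e)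

/-- `V` is a minimal countably complete boolean lattice over `M`: no proper subset contains `M` and
is closed under complements and countable (in particular binary) meets and joins. -/
structure IsMinimalOver {M V : Type*} [Preorder V] (r : M → M → Prop) (ι : M → V) : Prop where
  lattice : IsCCBooleanLattice V
  part : IsPart r ι
  minimal : ∀ V₀ : Set V, (∀ a, ι a ∈ V₀) →
    (∀ a c, a ∈ V₀ → Complementary a c → c ∈ V₀) →
    (∀ s c, s ⊆ V₀ → s.Countable → IsGLB s c → c ∈ V₀) →
    (∀ s c, s ⊆ V₀ → s.Countable → IsLUB s c → c ∈ V₀) → V₀ = Set.univ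

/-- A homomorphism of countably complete boolean lattices from `V` onto `V'` over `M`. -/
structure IsHomOnto {M V V' : Type*} [Preorder V] [Preorder V'] (ι : M → V) (ι' : M → V')
    (φ : V → V') : Prop where
  mono : ∀ a b, a ≤ b → φ a ≤ φ b
  map_compl : ∀ a b, Complementary a b → Complementary (φ a) (φ b)
  map_isGLB : ∀ s c, s.Countable → IsGLB s c → IsGLB (φ '' s) (φ c)
  map_isLUB : ∀ s c, s.Countable → IsLUB s c → IsLUB (φ '' s) (φ c)
  map_over : ∀ a, φ (ι a) ≤ ι' a ∧ ι' a ≤ φ (ι a)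
  onto : ∀ v', ∃ v, φ v ≤ v' ∧ v' ≤ φ v

/-- `V` is the free countably complete boolean lattice over `M`: it is minimal over `M`, and each
minimal countably complete boolean lattice over `M` is homomorphic to it over `M`. -/
structure IsFreeOver {M : Type} {V : Type u} [Preorder V] (r : M → M → Prop) (ι : M → V) :
    Prop where
  minimalOver : IsMinimalOver r ι
  hom : ∀ (V' : Type u) [Preorder V'] (ι' : M → V'), IsMinimalOver r ι' →
    ∃ φ : V → V', IsHomOnto ι ι' φ

/-! ### The calculus of numerical formulas -/

/-- Further relations between numbers (such as `α + β = γ` and `α · β = γ`) that are admitted as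
numerical formulas beside `α > β`, each with an arity and an interpretation. -/
structure NumRel where
  ι : Type
  ar : ι → ℕ
  Holds : (i : ι) → (Fin (ar i) → ℕ+) → Prop

/-- Formulas of `Z₀`. The numbers `1`, `1+1`, `1+1+1`, … are represented by `ℕ+`. -/
inductive Z0Form (N : NumRel) : Type
  | tru : Z0Form N
  | fls : Z0Form N
  | gt (α β : ℕ+) : Z0Form N
  | atom (i : N.ι) (α : Fin (N.ar i) → ℕ+) : Z0Form N

/-- The interpretation of the formulas of `Z₀`. -/
def Z0Form.Holds {N : NumRel} : Z0Form N → Prop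
  | .tru => True
  | .fls => False
  | .gt α β => α > β
  | .atom i α => N.Holds i α

/-- `Z0 a b`: the expression `a < b` is a theorem of `Z₀`. -/
inductive Z0 {N : NumRel} : Z0Form N → Z0Form N → Prop
  | t1 {a b} : (a.Holds → b.Holds) → Z0 a b
  | t2 (a) : Z0 a a
  | t2_fls (a) : Z0 .fls a
  | t2_tru (a) : Z0 a .tru
  | t3 {a b c} : Z0 a c → Z0 c b → Z0 a b

/-! ### Ramified types, terms and formulas -/

/-- Types: the type of numbers and `ν(τ₁ … τₖ)`. -/
inductive Ty : Type
  | num : Ty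
  | rel (ν : ℕ) {k : ℕ} (τ : Fin k → Ty) : Ty

def Ty.order : Ty → ℕ
  | .num => 0
  | .rel ν _ => ν

/-- In a type of order `ν`, the argument types have order less than `ν`. -/
def Ty.IsRamified : Ty → Prop
  | .num => True
  | .rel (k := k) ν τ => 0 < k ∧ ∀ i, (τ i).order < ν ∧ (τ i).IsRamified

/-- A system of ramified types: it contains the type of numbers and, with a type, its argument
types. Examples are the system of all ramified types, and the system of the types of numbers and of
sets of numbers of each order. -/
structure IsTypeSystem (S : Set Ty) : Prop where
  ramified : ∀ τ ∈ S, τ.IsRamified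
  num_mem : Ty.num ∈ S
  arg_mem : ∀ (ν k : ℕ) (τ : Fin k → Ty), Ty.rel ν τ ∈ S → ∀ i, τ i ∈ S

/-- The types of order at most `n`. -/
def upTo (S : Set Ty) (n : ℕ) : Set Ty := {τ ∈ S | τ.order ≤ n}

/-- For each type there are countably many variables. -/
abbrev Var : Type := Ty × ℕ

inductive Kind : Type
  | form : Kind
  | term (τ : Ty) : Kind

/-- Formulas and terms. The term `set ν τ x a` is the set (relation) of order `ν` of all
`x₁, …, xₖ` with `a`, where `xⱼ` is the variable `(τ j, x j)`; the formula `mem s A` says that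
`s₁, …, sₖ` is in `A`. -/
inductive Ex (N : NumRel) : Kind → Type
  | var (τ : Ty) (i : ℕ) : Ex N (.term τ)
  | num (α : ℕ+) : Ex N (.term .num)
  | set (ν : ℕ) {k : ℕ} (τ : Fin k → Ty) (x : Fin k → ℕ) (a : Ex N .form) :
      Ex N (.term (.rel ν τ))
  | tru : Ex N .form
  | fls : Ex N .form
  | gt (s t : Ex N (.term .num)) : Ex N .form
  | atom (i : N.ι) (s : Fin (N.ar i) → Ex N (.term .num)) : Ex N .form
  | mem {ν k : ℕ} {τ : Fin k → Ty} (s : ∀ j, Ex N (.term (τ j))) (A : Ex N (.term (.rel ν τ))) :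
      Ex N .form
  | and (a b : Ex N .form) : Ex N .form
  | or (a b : Ex N .form) : Ex N .form
  | not (a : Ex N .form) : Ex N .form
  | all (τ : Ty) (i : ℕ) (a : Ex N .form) : Ex N .form
  | ex (τ : Ty) (i : ℕ) (a : Ex N .form) : Ex N .form

abbrev Term (N : NumRel) (τ : Ty) : Type := Ex N (.term τ)

abbrev Form (N : NumRel) : Type := Ex N .form

def Z0Form.toForm {N : NumRel} : Z0Form N → Form N
  | .tru => .tru
  | .fls => .fls
  | .gt α β => .gt (.num α) (.num β)
  | .atom i α => .atom i fun j => .num (α j)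

/-- The variable `v` occurs free. -/
def Ex.Free {N : NumRel} (v : Var) : ∀ {κ : Kind}, Ex N κ → Prop
  | _, .var τ i => (τ, i) = v
  | _, .num _ => False
  | _, .set _ τ x a => a.Free v ∧ ∀ j, (τ j, x j) ≠ v
  | _, .tru => False
  | _, .fls => False
  | _, .gt s t => s.Free v ∨ t.Free v
  | _, .atom _ s => ∃ j, (s j).Free v
  | _, .mem s A => (∃ j, (s j).Free v) ∨ A.Free v
  | _, .and a b => a.Free v ∨ b.Free v
  | _, .or a b => a.Free v ∨ b.Free v
  | _, .not a => a.Free v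
  | _, .all τ i a => a.Free v ∧ (τ, i) ≠ v
  | _, .ex τ i a => a.Free v ∧ (τ, i) ≠ v

def Ex.Closed {N : NumRel} {κ : Kind} (e : Ex N κ) : Prop := ∀ v, ¬ e.Free v

open Classical in
/-- Replacement of the free occurrences of the variable `v` by `c`. It is used only for closed `c`,
so that no variable can be captured. -/
noncomputable def Ex.subst {N : NumRel} :
    ∀ {κ : Kind}, Ex N κ → (v : Var) → Term N v.1 → Ex N κ
  | _, .var τ i, v, c =>
      if h : v = (τ, i) then cast (congrArg (fun w : Var => Term N w.1) h) c else .var τ i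
  | _, .num α, _, _ => .num α
  | _, .set ν τ x a, v, c =>
      if ∃ j, (τ j, x j) = v then .set ν τ x a else .set ν τ x (a.subst v c)
  | _, .tru, _, _ => .tru
  | _, .fls, _, _ => .fls
  | _, .gt s t, v, c => .gt (s.subst v c) (t.subst v c)
  | _, .atom i s, v, c => .atom i fun j => (s j).subst v c
  | _, .mem s A, v, c => .mem (fun j => (s j).subst v c) (A.subst v c)
  | _, .and a b, v, c => .and (a.subst v c) (b.subst v c)
  | _, .or a b, v, c => .or (a.subst v c) (b.subst v c)
  | _, .not a, v, c => .not (a.subst v c)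
  | _, .all τ i a, v, c => if (τ, i) = v then .all τ i a else .all τ i (a.subst v c)
  | _, .ex τ i a, v, c => if (τ, i) = v then .ex τ i a else .ex τ i (a.subst v c)

/-- The expression belongs to the language over the types in `T`: its variables (free and bound)
and sets have types in `T`, and each set of order `ν` is formed from a formula of the language over
the types in `T` of order less than `ν`, by means of pairwise distinct variables. -/
def Ex.Over {N : NumRel} : ∀ {κ : Kind}, Ex N κ → Set Ty → Prop
  | _, .var τ _, T => τ ∈ T
  | _, .num _, _ => True
  | _, .set ν τ x a, T =>
      Ty.rel ν τ ∈ T ∧ (Function.Injective fun j => (τ j, x j)) ∧ a.Over {σ ∈ T | σ.order < ν}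
  | _, .tru, _ => True
  | _, .fls, _ => True
  | _, .gt s t, T => s.Over T ∧ t.Over T
  | _, .atom _ s, T => ∀ j, (s j).Over T
  | _, .mem s A, T => (∀ j, (s j).Over T) ∧ A.Over T
  | _, .and a b, T => a.Over T ∧ b.Over T
  | _, .or a b, T => a.Over T ∧ b.Over T
  | _, .not a, T => a.Over T
  | _, .all τ _ a, T => τ ∈ T ∧ a.Over T
  | _, .ex τ _ a, T => τ ∈ T ∧ a.Over T

/-! ### The calculi with variables -/

/-- `Thm T F a b`: the expression `a < b` is a theorem of the calculus whose formulas are those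
with `F`, whose variables have types in `T`, and in which the rules for the connectives and
quantifiers hold for the formulas of the language over `T`.

In `t10` the premisses range over the constants, that is the closed terms, of the type of the
variable `v`: these are the numbers for number variables, and the closed sets of type `τ` for set
variables of type `τ`. -/
inductive Thm {N : NumRel} (T : Set Ty) (F : Form N → Prop) : Form N → Form N → Prop
  | t1 {a b : Z0Form N} : (a.Holds → b.Holds) → Thm T F a.toForm b.toForm
  | t1_set_in {ν k : ℕ} {τ : Fin k → Ty} {x : Fin k → ℕ} {a : Form N} :
      F (.mem (fun j => .var (τ j) (x j)) (.set ν τ x a)) →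
      Thm T F a (.mem (fun j => .var (τ j) (x j)) (.set ν τ x a))
  | t1_set_out {ν k : ℕ} {τ : Fin k → Ty} {x : Fin k → ℕ} {a : Form N} :
      F (.mem (fun j => .var (τ j) (x j)) (.set ν τ x a)) →
      Thm T F (.mem (fun j => .var (τ j) (x j)) (.set ν τ x a)) a
  | t2 {a} : F a → Thm T F a a
  | t2_fls {a} : F a → Thm T F .fls a
  | t2_tru {a} : F a → Thm T F a .tru
  | t3 {a b c} : Thm T F a c → Thm T F c b → Thm T F a b
  | t4 {a b₁ b₂} : a.Over T → b₁.Over T → b₂.Over T →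
      Thm T F a b₁ → Thm T F a b₂ → Thm T F a (.and b₁ b₂)
  | t4_left {a b₁ b₂} : a.Over T → b₁.Over T → b₂.Over T → Thm T F a (.and b₁ b₂) → Thm T F a b₁
  | t4_right {a b₁ b₂} : a.Over T → b₁.Over T → b₂.Over T → Thm T F a (.and b₁ b₂) → Thm T F a b₂
  | t5 {a₁ a₂ b} : a₁.Over T → a₂.Over T → b.Over T →
      Thm T F a₁ b → Thm T F a₂ b → Thm T F (.or a₁ a₂) b
  | t5_left {a₁ a₂ b} : a₁.Over T → a₂.Over T → b.Over T → Thm T F (.or a₁ a₂) b → Thm T F a₁ b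
  | t5_right {a₁ a₂ b} : a₁.Over T → a₂.Over T → b.Over T → Thm T F (.or a₁ a₂) b → Thm T F a₂ b
  | t6 {a b c} : a.Over T → b.Over T → c.Over T →
      Thm T F (.and a c) b → Thm T F a (.or b (.not c))
  | t7 {a b c} : a.Over T → b.Over T → c.Over T →
      Thm T F a (.or b c) → Thm T F (.and a (.not c)) b
  | t8 {a b τ i} : τ ∈ T → a.Over T → b.Over T → ¬ a.Free (τ, i) →
      Thm T F a b → Thm T F a (.all τ i b)
  | t8_conv {a b τ i} : τ ∈ T → a.Over T → b.Over T → ¬ a.Free (τ, i) →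
      Thm T F a (.all τ i b) → Thm T F a b
  | t9 {a b τ i} : τ ∈ T → a.Over T → b.Over T → ¬ b.Free (τ, i) →
      Thm T F a b → Thm T F (.ex τ i a) b
  | t9_conv {a b τ i} : τ ∈ T → a.Over T → b.Over T → ¬ b.Free (τ, i) →
      Thm T F (.ex τ i a) b → Thm T F a b
  | t10 {a b} {v : Var} : v.1 ∈ T → F a → F b →
      (∀ c : Term N v.1, c.Closed → c.Over T → Thm T F (a.subst v c) (b.subst v c)) → Thm T F a b
  | t10_conv {a b} {v : Var} (c : Term N v.1) : v.1 ∈ T → c.Closed → c.Over T →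
      Thm T F a b → Thm T F (a.subst v c) (b.subst v c)

/-- The calculus with variables, connectives and quantifiers for all types in `T`, and with all
sets whose types are in `T`. For a type system `T` of ramified types, this is ramified type logic
including arithmetic over the types in `T`. -/
def K {N : NumRel} (T : Set Ty) : Form N → Form N → Prop := Thm T fun a => a.Over T

/-- The calculus `K₀`, arithmetic. -/
def K0 {N : NumRel} : Form N → Form N → Prop := K {Ty.num}

/-- The calculus `Kₙ` over the type system `S`. -/
def KStage {N : NumRel} (S : Set Ty) (n : ℕ) : Form N → Form N → Prop := K (upTo S n)

/-- The formulas of `Zₙ₊₁` over the type system `S`: those of `Kₙ`, and the formulas that assert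
membership in a set of order `n + 1`, formed from a formula of `Kₙ`. -/
def IsZForm {N : NumRel} (S : Set Ty) (n : ℕ) (a : Form N) : Prop :=
  a.Over (upTo S n) ∨
    ∃ (k : ℕ) (τ : Fin k → Ty) (x : Fin k → ℕ) (b : Form N) (s : ∀ j, Term N (τ j)),
      (∀ j, (s j).Over (upTo S n)) ∧ Ex.Over (.set (n + 1) τ x b : Term N _) (upTo S (n + 1)) ∧
      a = .mem s (.set (n + 1) τ x b)

/-- The calculus `Zₙ₊₁` over the type system `S`: the sets of order `n + 1` are added to `Kₙ`, but
neither connectives and quantifiers for the new formulas nor variables for the new sets. -/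
def ZStage {N : NumRel} (S : Set Ty) (n : ℕ) : Form N → Form N → Prop :=
  Thm (upTo S n) (IsZForm S n)

/-! ### The part of `K₀` without free variables -/

/-- The formulas of `K₀` without free variables. -/
def IsSentence {N : NumRel} (a : Form N) : Prop := a.Over {Ty.num} ∧ a.Closed

/-- `K0' a b`: the expression `a < b`, without free variables, is a theorem of `K₀'`, the calculus
in which the rules for variables are replaced by infinitary rules for the quantifiers. -/
inductive K0' {N : NumRel} : Form N → Form N → Prop
  | t1 {a b : Z0Form N} : (a.Holds → b.Holds) → K0' a.toForm b.toForm
  | t2 {a} : IsSentence a → K0' a a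
  | t2_fls {a} : IsSentence a → K0' .fls a
  | t2_tru {a} : IsSentence a → K0' a .tru
  | t3 {a b c} : K0' a c → K0' c b → K0' a b
  | t4 {a b₁ b₂} : K0' a b₁ → K0' a b₂ → K0' a (.and b₁ b₂)
  | t4_left {a b₁ b₂} : K0' a (.and b₁ b₂) → K0' a b₁
  | t4_right {a b₁ b₂} : K0' a (.and b₁ b₂) → K0' a b₂
  | t5 {a₁ a₂ b} : K0' a₁ b → K0' a₂ b → K0' (.or a₁ a₂) b
  | t5_left {a₁ a₂ b} : K0' (.or a₁ a₂) b → K0' a₁ b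
  | t5_right {a₁ a₂ b} : K0' (.or a₁ a₂) b → K0' a₂ b
  | t6 {a b c} : K0' (.and a c) b → K0' a (.or b (.not c))
  | t7 {a b c} : K0' a (.or b c) → K0' (.and a (.not c)) b
  | all {a b i} : IsSentence (.all .num i b) →
      (∀ γ : ℕ+, K0' a (b.subst (.num, i) (.num γ))) → K0' a (.all .num i b)
  | all_conv {a b i} (γ : ℕ+) : K0' a (.all .num i b) → K0' a (b.subst (.num, i) (.num γ))
  | ex {a b i} : IsSentence (.ex .num i a) →
      (∀ γ : ℕ+, K0' (a.subst (.num, i) (.num γ)) b) → K0' (.ex .num i a) b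
  | ex_conv {a b i} (γ : ℕ+) : K0' (.ex .num i a) b → K0' (a.subst (.num, i) (.num γ)) b

/-- `f` maps `K₀'` isomorphically into the lattice `V`, over `Z₀`: it reflects theoremhood exactly,
is the given embedding on the formulas of `Z₀`, and takes the connectives and quantifiers to the
operations of `V`. -/
structure IsIsoInto {N : NumRel} {V : Type*} [Preorder V] (ι : Z0Form N → V) (f : Form N → V) :
    Prop where
  le_iff : ∀ a b, IsSentence a → IsSentence b → (K0' a b ↔ f a ≤ f b)
  map_over : ∀ a : Z0Form N, f a.toForm ≤ ι a ∧ ι a ≤ f a.toForm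
  map_and : ∀ a b, IsSentence a → IsSentence b → IsGLB {f a, f b} (f (.and a b))
  map_or : ∀ a b, IsSentence a → IsSentence b → IsLUB {f a, f b} (f (.or a b))
  map_not : ∀ a, IsSentence a → Complementary (f a) (f (.not a))
  map_all : ∀ i b, IsSentence (.all .num i b) →
    IsGLB (Set.range fun γ : ℕ+ => f (b.subst (.num, i) (.num γ))) (f (.all .num i b))
  map_ex : ∀ i b, IsSentence (.ex .num i b) →
    IsLUB (Set.range fun γ : ℕ+ => f (b.subst (.num, i) (.num γ))) (f (.ex .num i b))

end Ramified

/-!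
The calculi are interpreted in the full type hierarchy over the positive integers, with the
quantifiers of type `τ` restricted to the values of the closed terms of type `τ`. This is not
circular, because a closed term of order `ν` contains quantifiers of order less than `ν` only. All
rules are sound for this interpretation, the rule (T10) because every object in the range of a
variable is the value of a closed term; so none of the calculi proves `⊤ < ⊥`.

For formulas of `K₀` without free variables this is truth in the standard model of arithmetic, and
the infinitary quantifier rules of `K₀'` prove every true sentence and refute every false one. Since
`Z₀` proves `a < b` as soon as "if `a` then `b`" is true, it is up to equivalence the two-element
preorder of truth values, and a minimal lattice over it cannot grow beyond these two elements: the
isomorphism of `K₀'` into the free lattice sends a sentence to its truth value.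
-/

namespace Ramified

variable {N : NumRel}

/-! ### Values of terms and formulas -/

noncomputable instance Ty.instDecidableEq : DecidableEq Ty := Classical.decEq Ty

/-- The objects of each type in the full type hierarchy over the positive integers. The order of a
type plays no role here. -/
def Ty.Dom : Ty → Type
  | .num => ℕ+
  | .rel _ τ => (∀ j, (τ j).Dom) → Prop

instance Ty.instInhabitedDom : ∀ τ : Ty, Inhabited τ.Dom
  | .num => ⟨(1 : ℕ+)⟩
  | .rel _ _ => ⟨fun _ => False⟩

/-- The possible values of an expression of a given kind. -/
abbrev Kind.Dom : Kind → Type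
  | .form => Prop
  | .term τ => τ.Dom

/-- A choice of values for all variables. -/
abbrev Assignment : Type := ∀ v : Var, v.1.Dom

/-- `σ` is the assignment `ρ` with the values of the variables `(τ j, x j)` changed to `d j`.
For a repeated variable with two different values there is no such `σ`. -/
structure Assignment.IsUpdate (ρ : Assignment) {k : ℕ} (τ : Fin k → Ty) (x : Fin k → ℕ)
    (d : ∀ j, (τ j).Dom) (σ : Assignment) : Prop where
  apply_eq : ∀ j, σ (τ j, x j) = d j
  eq_of_ne : ∀ v, (∀ j, (τ j, x j) ≠ v) → σ v = ρ v

namespace Assignment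

variable {ρ σ : Assignment} {k : ℕ} {τ : Fin k → Ty} {x : Fin k → ℕ} {d : ∀ j, (τ j).Dom} {v : Var}

theorem isUpdate_self_iff : ρ.IsUpdate τ x (fun j => ρ (τ j, x j)) σ ↔ σ = ρ := by
  refine ⟨fun h => funext fun v => ?_, by rintro rfl; exact ⟨fun _ => rfl, fun _ _ => rfl⟩⟩
  by_cases hv : ∀ j, (τ j, x j) ≠ v
  · exact h.eq_of_ne v hv
  · push Not at hv
    obtain ⟨j, rfl⟩ := hv
    exact h.apply_eq j

open Classical in
theorem IsUpdate.piecewise (h : ρ.IsUpdate τ x d σ) (ρ' : Assignment) :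
    ρ'.IsUpdate τ x d ({v | ∃ j, (τ j, x j) = v}.piecewise σ ρ') where
  apply_eq j := by rw [Set.piecewise_eq_of_mem _ _ _ (Set.mem_ofPred_eq ▸ ⟨j, rfl⟩), h.apply_eq]
  eq_of_ne _ hv := Set.piecewise_eq_of_notMem _ _ _ fun ⟨j, hj⟩ => hv j hj

theorem IsUpdate.update (h : ρ.IsUpdate τ x d σ) (hv : ∀ j, (τ j, x j) ≠ v) (e : v.1.Dom) :
    IsUpdate (Function.update ρ v e) τ x d (Function.update σ v e) where
  apply_eq j := by rw [Function.update_of_ne (hv j), h.apply_eq]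
  eq_of_ne w hw := by
    by_cases hwv : w = v
    · subst hwv; simp only [Function.update_self]
    · rw [Function.update_of_ne hwv, Function.update_of_ne hwv, h.eq_of_ne w hw]

theorem isUpdate_update_iff_of_mem {j : Fin k} (hj : (τ j, x j) = v) (e : v.1.Dom) :
    IsUpdate (Function.update ρ v e) τ x d σ ↔ ρ.IsUpdate τ x d σ := by
  have hne : ∀ w, (∀ j, (τ j, x j) ≠ w) → Function.update ρ v e w = ρ w := fun w hw =>
    Function.update_of_ne (fun hwv => hw j (hj.trans hwv.symm)) _ _
  exact ⟨fun h => ⟨h.apply_eq, fun w hw => (h.eq_of_ne w hw).trans (hne w hw)⟩,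
    fun h => ⟨h.apply_eq, fun w hw => (h.eq_of_ne w hw).trans (hne w hw).symm⟩⟩

theorem exists_isUpdate_update_iff (hv : ∀ j, (τ j, x j) ≠ v) (e : v.1.Dom)
    {P : Assignment → Prop} :
    (∃ σ, IsUpdate (Function.update ρ v e) τ x d σ ∧ P σ) ↔
      ∃ σ, ρ.IsUpdate τ x d σ ∧ P (Function.update σ v e) := by
  refine ⟨fun ⟨σ, hσ, hP⟩ => ⟨Function.update σ v (ρ v), ?_, ?_⟩,
    fun ⟨σ, hσ, hP⟩ => ⟨_, hσ.update hv e, hP⟩⟩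
  · simpa only [Function.update_idem, Function.update_eq_self] using hσ.update hv (ρ v)
  · have hσv : σ v = e := by simpa only [Function.update_self] using hσ.eq_of_ne v hv
    rwa [Function.update_idem, ← hσv, Function.update_eq_self]

end Assignment

namespace Ex

variable {κ : Kind} {U U' : ∀ τ : Ty, Set τ.Dom} {ρ ρ' : Assignment} {v : Var} {T : Set Ty}

/-- The value of a term or formula, where the quantifiers for the type `τ` range over `U τ`. -/
noncomputable def eval (U : ∀ τ : Ty, Set τ.Dom) : ∀ {κ : Kind}, Ex N κ → Assignment → κ.Dom
  | _, .var τ i, ρ => ρ (τ, i)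
  | _, .num α, _ => α
  | _, .set _ τ x a, ρ => fun d => ∃ σ, ρ.IsUpdate τ x d σ ∧ (a.eval U σ : Prop)
  | _, .tru, _ => True
  | _, .fls, _ => False
  | _, .gt s t, ρ => (show ℕ+ from s.eval U ρ) > (show ℕ+ from t.eval U ρ)
  | _, .atom i s, ρ => N.Holds i fun j => (s j).eval U ρ
  | _, .mem s A, ρ => (A.eval U ρ : _ → Prop) fun j => (s j).eval U ρ
  | _, .and a b, ρ => (a.eval U ρ : Prop) ∧ (b.eval U ρ : Prop)
  | _, .or a b, ρ => (a.eval U ρ : Prop) ∨ (b.eval U ρ : Prop)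
  | _, .not a, ρ => ¬ (a.eval U ρ : Prop)
  | _, .all τ i a, ρ => ∀ d ∈ U τ, (a.eval U (Function.update ρ (τ, i) d) : Prop)
  | _, .ex τ i a, ρ => ∃ d ∈ U τ, (a.eval U (Function.update ρ (τ, i) d) : Prop)

theorem eval_congr (e : Ex N κ) (h : ∀ v, e.Free v → ρ v = ρ' v) : e.eval U ρ = e.eval U ρ' := by
  induction e generalizing ρ ρ' with
  | var τ i => exact h _ rfl
  | num α => rfl
  | set ν τ x a ih =>
    have transfer : ∀ {ρ ρ' : Assignment} {d}, (∀ v, (Ex.set ν τ x a).Free v → ρ v = ρ' v) →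
        (∃ σ, ρ.IsUpdate τ x d σ ∧ (a.eval U σ : Prop)) →
          ∃ σ, ρ'.IsUpdate τ x d σ ∧ (a.eval U σ : Prop) := by
      rintro ρ ρ' d h ⟨σ, hσ, ha⟩
      refine ⟨_, hσ.piecewise ρ', (ih fun v hv => ?_).mp ha⟩
      by_cases hx : v ∈ {v | ∃ j, (τ j, x j) = v}
      · rw [Set.piecewise_eq_of_mem _ _ _ hx]
      · rw [Set.piecewise_eq_of_notMem _ _ _ hx, ← h v ⟨hv, not_exists.1 hx⟩,
          hσ.eq_of_ne v (not_exists.1 hx)]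
    exact funext fun d => propext ⟨transfer h, transfer fun v hv => (h v hv).symm⟩
  | tru => rfl
  | fls => rfl
  | gt s t ihs iht =>
    simp only [eval, ihs fun v hv => h v (Or.inl hv), iht fun v hv => h v (Or.inr hv)]
  | atom i s ih => simp only [eval, fun j => ih j fun v hv => h v ⟨j, hv⟩]
  | mem s A ihs ihA =>
    simp only [eval, fun j => ihs j fun v hv => h v (Or.inl ⟨j, hv⟩),
      ihA fun v hv => h v (Or.inr hv)]
  | and a b iha ihb | or a b iha ihb =>
    simp only [eval, iha fun v hv => h v (Or.inl hv), ihb fun v hv => h v (Or.inr hv)]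
  | not a ih => simp only [eval, ih h]
  | all τ i a ih | ex τ i a ih =>
    have eval_update (d : τ.Dom) : a.eval U (Function.update ρ (τ, i) d) =
        a.eval U (Function.update ρ' (τ, i) d) := by
      refine ih fun v hv => ?_
      by_cases hw : v = (τ, i)
      · subst hw; simp only [Function.update_self]
      · simpa only [Function.update_of_ne hw] using h v ⟨hv, Ne.symm hw⟩
    simp only [eval, eval_update]

theorem Closed.eval_eq {e : Ex N κ} (h : e.Closed) (ρ ρ' : Assignment) :
    e.eval U ρ = e.eval U ρ' :=
  e.eval_congr fun v hv => (h v hv).elim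

theorem eval_update_of_not_free {e : Ex N κ} (h : ¬ e.Free v) (ρ : Assignment) (d : v.1.Dom) :
    e.eval U (Function.update ρ v d) = e.eval U ρ :=
  e.eval_congr fun w hw => Function.update_of_ne (fun hwv : w = v => h (hwv ▸ hw)) _ _

theorem eval_subst (e : Ex N κ) {c : Term N v.1} (hc : c.Closed) (ρ : Assignment) :
    (e.subst v c).eval U ρ = e.eval U (Function.update ρ v (c.eval U ρ)) := by
  induction e generalizing ρ with
  | var τ i =>
    by_cases h : v = (τ, i)
    · subst h; simp only [subst, dite_true, cast_eq, eval, Function.update_self]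
    · simp only [subst, dif_neg h, eval, Function.update_of_ne (Ne.symm h)]
  | num α => rfl
  | set ν τ x a ih =>
    funext d
    by_cases h : ∃ j, (τ j, x j) = v
    · obtain ⟨j, hj⟩ := id h
      simp only [subst, if_pos h, eval, Assignment.isUpdate_update_iff_of_mem hj]
    · simp only [subst, if_neg h, eval, ih, hc.eval_eq _ ρ,
        Assignment.exists_isUpdate_update_iff (not_exists.1 h)]
  | tru => rfl
  | fls => rfl
  | gt s t ihs iht => simp only [subst, eval, ihs, iht]
  | atom i s ih => simp only [subst, eval, ih]
  | mem s A ihs ihA => simp only [subst, eval, ihs, ihA]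
  | and a b iha ihb | or a b iha ihb => simp only [subst, eval, iha, ihb]
  | not a ih => simp only [subst, eval, ih]
  | all τ i a ih | ex τ i a ih =>
    by_cases h : (τ, i) = v
    · subst h; simp only [subst, if_true, eval, Function.update_idem]
    · simp only [subst, if_neg h, eval, ih, hc.eval_eq _ ρ, Function.update_comm h]

theorem closed_num (γ : ℕ+) : (num γ : Term N .num).Closed := fun _ h => h

theorem over_num (γ : ℕ+) (T : Set Ty) : (num γ : Term N .num).Over T := trivial

theorem Over.eval_congr {e : Ex N κ} (he : e.Over T) (hU : ∀ τ ∈ T, U τ = U' τ) (ρ : Assignment) :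
    e.eval U ρ = e.eval U' ρ := by
  induction e generalizing ρ T with
  | var | num | tru | fls => rfl
  | set ν τ x a ih =>
    funext d
    simp only [eval, ih he.2.2 fun τ hτ => hU τ hτ.1]
  | gt s t ihs iht => simp only [eval, ihs he.1 hU, iht he.2 hU]
  | atom i s ih => simp only [eval, fun j => ih j (he j) hU]
  | mem s A ihs ihA => simp only [eval, fun j => ihs j (he.1 j) hU, ihA he.2 hU]
  | and a b iha ihb | or a b iha ihb => simp only [eval, iha he.1 hU, ihb he.2 hU]
  | not a ih => simp only [eval, ih he hU]
  | all τ i a ih | ex τ i a ih => simp only [eval, hU τ he.1, ih he.2 hU]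

end Ex

/-! ### The ramified hierarchy of definable objects -/

/-- The values of the closed terms over `T`, when the quantifiers range over `U`. -/
def closedTermValues (N : NumRel) (T : Set Ty) (U : ∀ τ : Ty, Set τ.Dom) (τ : Ty) : Set τ.Dom :=
  {d | ∃ c : Term N τ, c.Closed ∧ c.Over T ∧ ∀ ρ, c.eval U ρ = d}

theorem closedTermValues_congr {T : Set Ty} {U U' : ∀ τ : Ty, Set τ.Dom} {τ : Ty}
    (h : ∀ σ : Ty, σ.order < τ.order → U σ = U' σ) :
    closedTermValues N T U τ = closedTermValues N T U' τ := by
  have eval_eq (c : Term N τ) (hc : c.Over T) (ρ : Assignment) : c.eval U ρ = c.eval U' ρ := by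
    cases c with
    | var | num => rfl
    | set ν τ x a =>
      funext d
      simp only [Ex.eval, hc.2.2.eval_congr fun σ hσ => h σ hσ.2]
  ext d
  simp only [closedTermValues, Set.mem_ofPred_eq]
  refine exists_congr fun c => and_congr_right fun _ => and_congr_right fun hc => ?_
  simp only [eval_eq c hc]

/-- The objects of type `τ` that are the values of closed terms over `T`, where the quantifiers in
these terms range over the definable objects of lower order. -/
def definable (N : NumRel) (T : Set Ty) (τ : Ty) : Set τ.Dom :=
  closedTermValues N T (fun σ => if _ : σ.order < τ.order then definable N T σ else ∅) τ
termination_by τ.order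

theorem definable_eq (T : Set Ty) (τ : Ty) :
    definable N T τ = closedTermValues N T (definable N T) τ := by
  rw [definable]
  exact closedTermValues_congr fun σ hσ => dif_pos hσ

theorem Ex.exists_closed_over {T : Set Ty} {τ : Ty} (h : τ ∈ T) :
    ∃ c : Term N τ, c.Closed ∧ c.Over T := by
  cases τ with
  | num => exact ⟨.num 1, closed_num 1, over_num 1 T⟩
  | rel ν τ =>
    exact ⟨.set ν τ (fun j => j) .fls, fun _ hv => hv.1, h,
      fun i j hij => Fin.ext (congrArg Prod.snd hij), trivial⟩

theorem Ex.Closed.eval_mem_definable {T : Set Ty} {τ : Ty} {c : Term N τ} (hc : c.Closed)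
    (ho : c.Over T) (ρ : Assignment) : c.eval (definable N T) ρ ∈ definable N T τ := by
  rw [definable_eq T τ]
  exact ⟨c, hc, ho, fun _ => hc.eval_eq _ _⟩

theorem definable_num (T : Set Ty) : definable N T .num = Set.univ :=
  Set.eq_univ_of_forall fun γ =>
    (Ex.closed_num γ).eval_mem_definable (Ex.over_num γ T) default

/-- The variables with types in `T` have definable values. -/
def Admissible (N : NumRel) (T : Set Ty) (ρ : Assignment) : Prop :=
  ∀ v : Var, v.1 ∈ T → ρ v ∈ definable N T v.1

theorem Admissible.update {T : Set Ty} {ρ : Assignment} (h : Admissible N T ρ) {v : Var}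
    {d : v.1.Dom} (hd : d ∈ definable N T v.1) : Admissible N T (Function.update ρ v d) := by
  intro w hw
  by_cases hv : w = v
  · subst hv; rwa [Function.update_self]
  · rw [Function.update_of_ne hv]; exact h w hw

theorem exists_admissible (N : NumRel) (T : Set Ty) : ∃ ρ, Admissible N T ρ := by
  have exists_value (v : Var) : ∃ d : v.1.Dom, v.1 ∈ T → d ∈ definable N T v.1 := by
    by_cases hv : v.1 ∈ T
    · obtain ⟨c, hc, ho⟩ := Ex.exists_closed_over (N := N) hv
      exact ⟨_, fun _ => hc.eval_mem_definable ho default⟩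
    · exact ⟨default, fun h => (hv h).elim⟩
  choose ρ hρ using exists_value
  exact ⟨ρ, hρ⟩

/-! ### Soundness -/

/-- Truth of a formula of the language over `T` in the ramified hierarchy of definable objects. -/
def Ex.Sat (T : Set Ty) (a : Form N) (ρ : Assignment) : Prop := a.eval (definable N T) ρ

section Sat

variable {T : Set Ty} {a : Form N} {ρ : Assignment}

theorem Z0Form.sat_toForm (a : Z0Form N) : a.toForm.Sat T ρ ↔ a.Holds := by
  cases a <;> exact Iff.rfl

theorem Ex.sat_mem_set {ν k : ℕ} {τ : Fin k → Ty} {x : Fin k → ℕ} :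
    Ex.Sat T (.mem (fun j => .var (τ j) (x j)) (.set ν τ x a)) ρ ↔ a.Sat T ρ := by
  change (∃ σ, ρ.IsUpdate τ x (fun j => ρ (τ j, x j)) σ ∧ a.Sat T σ) ↔ a.Sat T ρ
  simp only [Assignment.isUpdate_self_iff, exists_eq_left]

theorem Ex.sat_subst {v : Var} {c : Term N v.1} (hc : c.Closed) :
    (a.subst v c).Sat T ρ ↔ a.Sat T (Function.update ρ v (c.eval (definable N T) ρ)) :=
  iff_of_eq (a.eval_subst hc ρ)

theorem Ex.sat_update_of_not_free {v : Var} (h : ¬ a.Free v) (d : v.1.Dom) :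
    a.Sat T (Function.update ρ v d) ↔ a.Sat T ρ :=
  iff_of_eq (Ex.eval_update_of_not_free h ρ d)

theorem Ex.Closed.sat_iff (h : a.Closed) (ρ ρ' : Assignment) : a.Sat T ρ ↔ a.Sat T ρ' :=
  iff_of_eq (h.eval_eq ρ ρ')

end Sat

/-- Semantic counterpart of the expressions `a < b`. -/
def Entails (T : Set Ty) (a b : Form N) : Prop :=
  ∀ ρ, Admissible N T ρ → a.Sat T ρ → b.Sat T ρ

namespace Entails

variable {T : Set Ty} {a b : Form N} {τ : Ty} {i : ℕ} {v : Var}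

theorem all (hf : ¬ a.Free (τ, i)) (h : Entails T a b) : Entails T a (.all τ i b) :=
  fun _ hρ ha d hd => h _ (hρ.update hd) ((Ex.sat_update_of_not_free hf d).2 ha)

theorem of_all (hτ : τ ∈ T) (h : Entails T a (.all τ i b)) : Entails T a b := by
  intro ρ hρ ha
  have hb : b.Sat T (Function.update ρ (τ, i) (ρ (τ, i))) := h ρ hρ ha _ (hρ (τ, i) hτ)
  rwa [Function.update_eq_self] at hb

theorem ex (hf : ¬ b.Free (τ, i)) (h : Entails T a b) : Entails T (.ex τ i a) b :=
  fun _ hρ ⟨d, hd, ha⟩ => (Ex.sat_update_of_not_free hf d).1 (h _ (hρ.update hd) ha)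

theorem of_ex (hτ : τ ∈ T) (h : Entails T (.ex τ i a) b) : Entails T a b := by
  intro ρ hρ ha
  rw [← Function.update_eq_self (τ, i) ρ] at ha
  exact h ρ hρ ⟨_, hρ (τ, i) hτ, ha⟩

theorem subst {c : Term N v.1} (hc : c.Closed) (ho : c.Over T) (h : Entails T a b) :
    Entails T (a.subst v c) (b.subst v c) := by
  intro ρ hρ
  rw [Ex.sat_subst hc, Ex.sat_subst hc]
  exact h _ (hρ.update (hc.eval_mem_definable ho ρ))

theorem of_subst (hv : v.1 ∈ T)
    (h : ∀ c : Term N v.1, c.Closed → c.Over T → Entails T (a.subst v c) (b.subst v c)) :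
    Entails T a b := by
  intro ρ hρ
  have hd := hρ v hv
  rw [definable_eq] at hd
  obtain ⟨c, hc, ho, hcv⟩ := hd
  simpa only [Ex.sat_subst hc, hcv, Function.update_eq_self] using h c hc ho ρ hρ

end Entails

theorem Thm.entails {T : Set Ty} {F : Form N → Prop} {a b : Form N} (h : Thm T F a b) :
    Entails T a b := by
  induction h with
  | t1 h => exact fun _ _ => by simpa only [Z0Form.sat_toForm] using h
  | t1_set_in _ => exact fun _ _ => Ex.sat_mem_set.2
  | t1_set_out _ => exact fun _ _ => Ex.sat_mem_set.1
  | t2 _ => exact fun _ _ => id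
  | t2_fls _ => exact fun _ _ => False.elim
  | t2_tru _ => exact fun _ _ _ => trivial
  | t3 _ _ ih ih' => exact fun ρ hρ ha => ih' ρ hρ (ih ρ hρ ha)
  | t4 _ _ _ _ _ ih ih' => exact fun ρ hρ ha => ⟨ih ρ hρ ha, ih' ρ hρ ha⟩
  | t4_left _ _ _ _ ih => exact fun ρ hρ ha => (ih ρ hρ ha).1
  | t4_right _ _ _ _ ih => exact fun ρ hρ ha => (ih ρ hρ ha).2
  | t5 _ _ _ _ _ ih ih' => exact fun ρ hρ ha => ha.elim (ih ρ hρ) (ih' ρ hρ)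
  | t5_left _ _ _ _ ih => exact fun ρ hρ ha => ih ρ hρ (Or.inl ha)
  | t5_right _ _ _ _ ih => exact fun ρ hρ ha => ih ρ hρ (Or.inr ha)
  | t6 _ _ _ _ ih =>
    exact fun ρ hρ ha => (Classical.em _).elim (fun hc => Or.inl (ih ρ hρ ⟨ha, hc⟩)) Or.inr
  | t7 _ _ _ _ ih => exact fun ρ hρ ha => (ih ρ hρ ha.1).resolve_right ha.2
  | t8 _ _ _ hf _ ih => exact ih.all hf
  | t8_conv hτ _ _ _ _ ih => exact ih.of_all hτ
  | t9 _ _ _ hf _ ih => exact ih.ex hf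
  | t9_conv hτ _ _ _ _ ih => exact ih.of_ex hτ
  | t10 hv _ _ _ ih => exact .of_subst hv ih
  | t10_conv c _ hc ho _ ih => exact ih.subst hc ho

theorem Thm.consistent (T : Set Ty) (F : Form N → Prop) : ¬ Thm T F .tru .fls := by
  obtain ⟨ρ, hρ⟩ := exists_admissible N T
  exact fun h => h.entails ρ hρ trivial

/-! ### Substitution of closed terms -/

namespace Ex

variable {κ : Kind} {e : Ex N κ} {v w : Var} {c : Term N v.1}

theorem subst_eq_self (h : ¬ e.Free v) : e.subst v c = e := by
  induction e with
  | var τ i => exact dif_neg fun hv : v = (τ, i) => h hv.symm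
  | num | tru | fls => rfl
  | set ν τ x a ih =>
    by_cases hx : ∃ j, (τ j, x j) = v
    · simp only [subst, if_pos hx]
    · simp only [subst, if_neg hx, ih fun ha => h ⟨ha, not_exists.1 hx⟩]
  | gt s t ihs iht => simp only [subst, ihs fun hs => h (.inl hs), iht fun ht => h (.inr ht)]
  | atom i s ih => simp only [subst, fun j => ih j fun hs => h ⟨j, hs⟩]
  | mem s A ihs ihA =>
    simp only [subst, fun j => ihs j fun hs => h (.inl ⟨j, hs⟩), ihA fun hA => h (.inr hA)]
  | and a b iha ihb | or a b iha ihb =>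
    simp only [subst, iha fun ha => h (.inl ha), ihb fun hb => h (.inr hb)]
  | not a ih => simp only [subst, ih h]
  | all τ i a ih | ex τ i a ih =>
    by_cases hv : (τ, i) = v
    · simp only [subst, if_pos hv]
    · simp only [subst, if_neg hv, ih fun ha => h ⟨ha, hv⟩]

theorem Free.of_subst (hc : c.Closed) (h : (e.subst v c).Free w) : e.Free w ∧ v ≠ w := by
  induction e with
  | var τ i =>
    by_cases hv : v = (τ, i)
    · subst hv
      simp only [subst, dite_true, cast_eq] at h
      exact (hc w h).elim
    · simp only [subst, dif_neg hv] at h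
      exact ⟨h, fun hw => hv (hw.trans (Eq.symm h))⟩
  | num | tru | fls => exact h.elim
  | set ν τ x a ih =>
    by_cases hx : ∃ j, (τ j, x j) = v
    · simp only [subst, if_pos hx] at h
      obtain ⟨j, rfl⟩ := hx
      exact ⟨h, h.2 j⟩
    · simp only [subst, if_neg hx] at h
      exact ⟨⟨(ih h.1).1, h.2⟩, (ih h.1).2⟩
  | gt s t iha ihb | and a b iha ihb | or a b iha ihb =>
    exact h.elim (fun h => (iha h).imp_left .inl) fun h => (ihb h).imp_left .inr
  | atom i s ih => exact h.elim fun j h => (ih j h).imp_left (.intro j)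
  | mem s A ihs ihA =>
    exact h.elim (fun ⟨j, h⟩ => (ihs j h).imp_left fun h => .inl ⟨j, h⟩)
      fun h => (ihA h).imp_left .inr
  | not a ih => exact ih h
  | all τ i a ih | ex τ i a ih =>
    by_cases hv : (τ, i) = v
    · simp only [subst, if_pos hv] at h
      exact ⟨h, hv ▸ h.2⟩
    · simp only [subst, if_neg hv] at h
      exact ⟨⟨(ih h.1).1, h.2⟩, (ih h.1).2⟩

theorem Over.subst (hc : ∀ T : Set Ty, v.1 ∈ T → c.Over T) {T : Set Ty} (h : e.Over T) :
    (e.subst v c).Over T := by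
  induction e generalizing T with
  | var τ i =>
    by_cases hv : v = (τ, i)
    · subst hv; simpa only [Ex.subst, dite_true, cast_eq] using hc T h
    · simpa only [Ex.subst, dif_neg hv] using h
  | num | tru | fls => trivial
  | set ν τ x a ih =>
    by_cases hx : ∃ j, (τ j, x j) = v
    · simpa only [Ex.subst, if_pos hx] using h
    · simp only [Ex.subst, if_neg hx]
      exact ⟨h.1, h.2.1, ih h.2.2⟩
  | gt s t iha ihb | and a b iha ihb | or a b iha ihb => exact ⟨iha h.1, ihb h.2⟩
  | atom i s ih => exact fun j => ih j (h j)
  | mem s A ihs ihA => exact ⟨fun j => ihs j (h.1 j), ihA h.2⟩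
  | not a ih => exact ih h
  | all τ i a ih | ex τ i a ih =>
    by_cases hv : (τ, i) = v
    · simpa only [Ex.subst, if_pos hv] using h
    · simp only [Ex.subst, if_neg hv]
      exact ⟨h.1, ih h.2⟩

/-- The number of nested connectives and quantifiers outside of terms. Unlike the size of an
expression it is unchanged by substitution, so that inductions over sentences can run along it. -/
def depth : ∀ {κ : Kind}, Ex N κ → ℕ
  | _, .and a b => max a.depth b.depth + 1
  | _, .or a b => max a.depth b.depth + 1
  | _, .not a => a.depth + 1
  | _, .all _ _ a => a.depth + 1
  | _, .ex _ _ a => a.depth + 1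
  | _, _ => 0

theorem depth_term {τ : Ty} (t : Term N τ) : t.depth = 0 := by
  cases t <;> rfl

theorem depth_subst (e : Ex N κ) : (e.subst v c).depth = e.depth := by
  induction e with
  | var | num | set => rw [depth_term, depth_term]
  | tru | fls | gt | atom | mem => rfl
  | and a b iha ihb | or a b iha ihb => simp only [subst, depth, iha, ihb]
  | not a ih => simp only [subst, depth, ih]
  | all τ i a ih | ex τ i a ih =>
    by_cases hv : (τ, i) = v
    · simp only [subst, if_pos hv]
    · simp only [subst, if_neg hv, depth, ih]

theorem Closed.eq_num {c : Term N .num} (h : c.Closed) : ∃ γ, c = .num γ := by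
  cases c with
  | var τ i => exact (h _ rfl).elim
  | num γ => exact ⟨γ, rfl⟩

end Ex

/-! ### Sentences -/

namespace IsSentence

variable {a b : Form N} {i : ℕ}

theorem and_iff : IsSentence (.and a b) ↔ IsSentence a ∧ IsSentence b :=
  ⟨fun h => ⟨⟨h.1.1, fun v hv => h.2 v (.inl hv)⟩, ⟨h.1.2, fun v hv => h.2 v (.inr hv)⟩⟩,
    fun h => ⟨⟨h.1.1, h.2.1⟩, fun v hv => hv.elim (h.1.2 v) (h.2.2 v)⟩⟩

theorem or_iff : IsSentence (.or a b) ↔ IsSentence a ∧ IsSentence b :=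
  and_iff (a := a) (b := b)

theorem not_iff : IsSentence (.not a) ↔ IsSentence a := Iff.rfl

theorem fls : IsSentence (.fls : Form N) := ⟨trivial, fun _ h => h⟩

theorem tru : IsSentence (.tru : Form N) := ⟨trivial, fun _ h => h⟩

theorem toForm (a : Z0Form N) : IsSentence a.toForm := by
  cases a with
  | tru => exact .tru
  | fls => exact .fls
  | gt α β => exact ⟨⟨trivial, trivial⟩, fun v hv => hv.elim id id⟩
  | atom i α => exact ⟨fun _ => trivial, fun v ⟨_, hv⟩ => hv⟩

theorem all_inst (h : IsSentence (.all .num i a)) (γ : ℕ+) :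
    IsSentence (a.subst (.num, i) (.num γ)) :=
  ⟨h.1.2.subst (v := (.num, i)) fun T _ => Ex.over_num γ T,
    fun v hv => h.2 v (hv.of_subst (Ex.closed_num γ))⟩

theorem ex_inst (h : IsSentence (.ex .num i a)) (γ : ℕ+) :
    IsSentence (a.subst (.num, i) (.num γ)) :=
  all_inst (a := a) (i := i) h γ

theorem eq_toForm (h : IsSentence a) (hd : a.depth = 0) : ∃ a₀ : Z0Form N, a = a₀.toForm := by
  cases a with
  | tru => exact ⟨.tru, rfl⟩
  | fls => exact ⟨.fls, rfl⟩
  | gt s t =>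
    obtain ⟨α, rfl⟩ := Ex.Closed.eq_num fun v hv => h.2 v (.inl hv)
    obtain ⟨β, rfl⟩ := Ex.Closed.eq_num fun v hv => h.2 v (.inr hv)
    exact ⟨.gt α β, rfl⟩
  | atom i s =>
    choose α hα using fun j => Ex.Closed.eq_num (c := s j) fun v hv => h.2 v ⟨j, hv⟩
    exact ⟨.atom i α, congrArg (Ex.atom i) (funext hα)⟩
  | mem s A =>
    have hA := h.1.2
    cases A with
    | var τ i => cases hA
    | set ν τ x a => cases hA.1
  | _ => simp [Ex.depth] at hd

theorem induction {P : Form N → Prop} (toForm : ∀ a : Z0Form N, P a.toForm)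
    (and : ∀ a b, IsSentence (.and a b) → P a → P b → P (.and a b))
    (or : ∀ a b, IsSentence (.or a b) → P a → P b → P (.or a b))
    (not : ∀ a, IsSentence (.not a) → P a → P (.not a))
    (all : ∀ i a, IsSentence (.all .num i a) →
      (∀ γ : ℕ+, P (a.subst (.num, i) (.num γ))) → P (.all .num i a))
    (ex : ∀ i a, IsSentence (.ex .num i a) →
      (∀ γ : ℕ+, P (a.subst (.num, i) (.num γ))) → P (.ex .num i a))
    (ha : IsSentence a) : P a := by
  induction hn : a.depth using Nat.strong_induction_on generalizing a with
  | _ n ih =>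
    subst hn
    replace ih {b : Form N} (hb : IsSentence b) (hlt : b.depth + 1 ≤ a.depth) : P b :=
      ih _ hlt hb rfl
    cases a with
    | and a b =>
      have hab := and_iff.1 ha
      exact and a b ha (ih hab.1 (Nat.succ_le_succ (le_max_left _ _)))
        (ih hab.2 (Nat.succ_le_succ (le_max_right _ _)))
    | or a b =>
      have hab := or_iff.1 ha
      exact or a b ha (ih hab.1 (Nat.succ_le_succ (le_max_left _ _)))
        (ih hab.2 (Nat.succ_le_succ (le_max_right _ _)))
    | not a => exact not a ha (ih (not_iff.1 ha) le_rfl)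
    | all τ i a =>
      obtain rfl : τ = .num := ha.1.1
      exact all i a ha fun γ => ih (ha.all_inst γ) (by rw [Ex.depth_subst, Ex.depth])
    | ex τ i a =>
      obtain rfl : τ = .num := ha.1.1
      exact ex i a ha fun γ => ih (ha.ex_inst γ) (by rw [Ex.depth_subst, Ex.depth])
    | _ =>
      obtain ⟨a₀, h₀⟩ := ha.eq_toForm rfl
      exact h₀ ▸ toForm a₀

end IsSentence

/-! ### From infinitary rules to rules for variables -/

section Quantifiers

variable {T : Set Ty} {τ : Ty} {i : ℕ} {a b : Form N}

theorem K.all_iff_forall_closed (hτ : τ ∈ T) (ha : a.Over T) (hb : b.Over T)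
    (hf : ¬ a.Free (τ, i)) :
    K T a (.all τ i b) ↔
      ∀ c : Term N τ, c.Closed → c.Over T → K T a (b.subst (τ, i) c) := by
  have subst_a (c : Term N τ) : a.subst (τ, i) c = a := Ex.subst_eq_self hf
  constructor
  · intro h c hc ho
    rw [← subst_a c]
    exact .t10_conv (v := (τ, i)) c hτ hc ho (.t8_conv hτ ha hb hf h)
  · exact fun h => .t8 hτ ha hb hf <| .t10 (v := (τ, i)) hτ ha hb fun c hc ho =>
      (subst_a c).symm ▸ h c hc ho

theorem K.ex_iff_forall_closed (hτ : τ ∈ T) (ha : a.Over T) (hb : b.Over T)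
    (hf : ¬ b.Free (τ, i)) :
    K T (.ex τ i a) b ↔
      ∀ c : Term N τ, c.Closed → c.Over T → K T (a.subst (τ, i) c) b := by
  have subst_b (c : Term N τ) : b.subst (τ, i) c = b := Ex.subst_eq_self hf
  constructor
  · intro h c hc ho
    rw [← subst_b c]
    exact .t10_conv (v := (τ, i)) c hτ hc ho (.t9_conv hτ ha hb hf h)
  · exact fun h => .t9 hτ ha hb hf <| .t10 (v := (τ, i)) hτ ha hb fun c hc ho =>
      (subst_b c).symm ▸ h c hc ho

end Quantifiers

theorem K0.all_iff {a b : Form N} {i : ℕ} (ha : IsSentence a) (hb : IsSentence (.all .num i b)) :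
    K0 a (.all .num i b) ↔ ∀ γ : ℕ+, K0 a (b.subst (.num, i) (.num γ)) := by
  refine (K.all_iff_forall_closed (T := {Ty.num}) rfl ha.1 hb.1.2 (ha.2 _)).trans
    ⟨fun h γ => h _ (Ex.closed_num γ) (Ex.over_num γ _), fun h c hc _ => ?_⟩
  obtain ⟨γ, rfl⟩ := hc.eq_num
  exact h γ

theorem K0.ex_iff {a b : Form N} {i : ℕ} (ha : IsSentence (.ex .num i a)) (hb : IsSentence b) :
    K0 (.ex .num i a) b ↔ ∀ γ : ℕ+, K0 (a.subst (.num, i) (.num γ)) b := by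
  refine (K.ex_iff_forall_closed (T := {Ty.num}) rfl ha.1.2 hb.1 (hb.2 _)).trans
    ⟨fun h γ => h _ (Ex.closed_num γ) (Ex.over_num γ _), fun h c hc _ => ?_⟩
  obtain ⟨γ, rfl⟩ := hc.eq_num
  exact h γ

theorem K0'.isSentence {a b : Form N} (h : K0' a b) : IsSentence a ∧ IsSentence b := by
  induction h with
  | t1 _ => exact ⟨.toForm _, .toForm _⟩
  | t2 h => exact ⟨h, h⟩
  | t2_fls h => exact ⟨.fls, h⟩
  | t2_tru h => exact ⟨h, .tru⟩
  | t3 _ _ ih ih' => exact ⟨ih.1, ih'.2⟩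
  | t4 _ _ ih ih' => exact ⟨ih.1, IsSentence.and_iff.2 ⟨ih.2, ih'.2⟩⟩
  | t4_left _ ih => exact ⟨ih.1, (IsSentence.and_iff.1 ih.2).1⟩
  | t4_right _ ih => exact ⟨ih.1, (IsSentence.and_iff.1 ih.2).2⟩
  | t5 _ _ ih ih' => exact ⟨IsSentence.or_iff.2 ⟨ih.1, ih'.1⟩, ih.2⟩
  | t5_left _ ih => exact ⟨(IsSentence.or_iff.1 ih.1).1, ih.2⟩
  | t5_right _ ih => exact ⟨(IsSentence.or_iff.1 ih.1).2, ih.2⟩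
  | t6 _ ih =>
    obtain ⟨ha, hc⟩ := IsSentence.and_iff.1 ih.1
    exact ⟨ha, IsSentence.or_iff.2 ⟨ih.2, IsSentence.not_iff.2 hc⟩⟩
  | t7 _ ih =>
    obtain ⟨hb, hc⟩ := IsSentence.or_iff.1 ih.2
    exact ⟨IsSentence.and_iff.2 ⟨ih.1, IsSentence.not_iff.2 hc⟩, hb⟩
  | all h _ ih => exact ⟨(ih 1).1, h⟩
  | all_conv γ _ ih => exact ⟨ih.1, ih.2.all_inst γ⟩
  | ex h _ ih => exact ⟨h, (ih 1).2⟩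
  | ex_conv γ _ ih => exact ⟨ih.1.ex_inst γ, ih.2⟩

theorem K0'.toK0 {a b : Form N} (h : K0' a b) : K0 a b := by
  induction h with
  | t1 h => exact .t1 h
  | t2 h => exact .t2 h.1
  | t2_fls h => exact .t2_fls h.1
  | t2_tru h => exact .t2_tru h.1
  | t3 _ _ ih ih' => exact .t3 ih ih'
  | t4 h h' ih ih' => exact .t4 h.isSentence.1.1 h.isSentence.2.1 h'.isSentence.2.1 ih ih'
  | t4_left h ih => exact .t4_left h.isSentence.1.1 h.isSentence.2.1.1 h.isSentence.2.1.2 ih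
  | t4_right h ih => exact .t4_right h.isSentence.1.1 h.isSentence.2.1.1 h.isSentence.2.1.2 ih
  | t5 h h' ih ih' => exact .t5 h.isSentence.1.1 h'.isSentence.1.1 h.isSentence.2.1 ih ih'
  | t5_left h ih => exact .t5_left h.isSentence.1.1.1 h.isSentence.1.1.2 h.isSentence.2.1 ih
  | t5_right h ih => exact .t5_right h.isSentence.1.1.1 h.isSentence.1.1.2 h.isSentence.2.1 ih
  | t6 h ih => exact .t6 h.isSentence.1.1.1 h.isSentence.2.1 h.isSentence.1.1.2 ih
  | t7 h ih => exact .t7 h.isSentence.1.1 h.isSentence.2.1.1 h.isSentence.2.1.2 ih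
  | all hb h ih => exact (K0.all_iff (h 1).isSentence.1 hb).2 ih
  | all_conv γ h ih => exact (K0.all_iff h.isSentence.1 h.isSentence.2).1 ih γ
  | ex ha h ih => exact (K0.ex_iff ha (h 1).isSentence.2).2 ih
  | ex_conv γ h ih => exact (K0.ex_iff h.isSentence.1 h.isSentence.2).1 ih γ

/-! ### Completeness of the infinitary rules for arithmetical truth -/

/-- Truth of a formula of `K₀` without free variables in the standard model of arithmetic. The
assignment `default` only serves to evaluate such formulas. -/
def IsTrue (a : Form N) : Prop := a.Sat {Ty.num} default

namespace IsTrue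

variable {a b : Form N} {i : ℕ}

theorem toForm_iff (a : Z0Form N) : IsTrue a.toForm ↔ a.Holds := a.sat_toForm

theorem and_iff : IsTrue (.and a b) ↔ IsTrue a ∧ IsTrue b := Iff.rfl

theorem or_iff : IsTrue (.or a b) ↔ IsTrue a ∨ IsTrue b := Iff.rfl

theorem not_iff : IsTrue (.not a) ↔ ¬ IsTrue a := Iff.rfl

theorem subst_iff {γ : ℕ+} : IsTrue (a.subst (.num, i) (.num γ)) ↔
    a.Sat {Ty.num} (Function.update (default : Assignment) (.num, i) γ) :=
  Ex.sat_subst (Ex.closed_num γ)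

theorem all_iff :
    IsTrue (.all .num i a) ↔ ∀ γ : ℕ+, IsTrue (a.subst (.num, i) (.num γ)) := by
  simp only [subst_iff]
  change (∀ γ ∈ definable N {Ty.num} .num, _) ↔ _
  simp only [definable_num, Set.mem_univ, true_imp_iff]
  rfl

theorem ex_iff :
    IsTrue (.ex .num i a) ↔ ∃ γ : ℕ+, IsTrue (a.subst (.num, i) (.num γ)) := by
  simp only [subst_iff]
  change (∃ γ ∈ definable N {Ty.num} .num, _) ↔ _
  simp only [definable_num, Set.mem_univ, true_and]
  rfl

end IsTrue

theorem K0.isTrue {a b : Form N} (ha : IsSentence a) (hb : IsSentence b) (h : K0 a b) :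
    IsTrue a → IsTrue b := by
  obtain ⟨ρ, hρ⟩ := exists_admissible N {Ty.num}
  intro h_true
  exact (hb.2.sat_iff ρ default).1 (h.entails ρ hρ ((ha.2.sat_iff ρ default).2 h_true))

namespace K0'

variable {a : Form N}

theorem tru_not (h : K0' a .fls) : K0' .tru (.not a) := by
  have ha := h.isSentence.1
  have tru_and : K0' (.and .tru a) .fls :=
    .t3 (.t4_right (.t2 (IsSentence.and_iff.2 ⟨.tru, ha⟩))) h
  exact .t3 (.t6 tru_and) (.t5 (.t2_fls ha) (.t2 ha))

theorem not_fls (h : K0' .tru a) : K0' (.not a) .fls := by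
  have ha := h.isSentence.2
  have fls_or : K0' .tru (.or .fls a) :=
    .t3 h (.t5_right (.t2 (IsSentence.or_iff.2 ⟨.fls, ha⟩)))
  exact .t3 (.t4 (.t2_tru ha) (.t2 ha)) (.t7 fls_or)

end K0'

/-- `K₀'` decides `a` in accordance with its truth value. -/
structure IsDecided (a : Form N) : Prop where
  proves : IsTrue a → K0' .tru a
  refutes : ¬ IsTrue a → K0' a .fls

namespace IsDecided

variable {a b : Form N} {i : ℕ}

theorem toForm (a : Z0Form N) : IsDecided a.toForm where
  proves h := .t1 (a := .tru) fun _ => (IsTrue.toForm_iff a).1 h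
  refutes h := .t1 (b := .fls) fun ha => h ((IsTrue.toForm_iff a).2 ha)

theorem and (h : IsSentence (.and a b)) (ha : IsDecided a) (hb : IsDecided b) :
    IsDecided (.and a b) where
  proves hab := .t4 (ha.proves hab.1) (hb.proves hab.2)
  refutes hab := by
    rcases not_and_or.1 hab with hab | hab
    · exact .t3 (.t4_left (.t2 h)) (ha.refutes hab)
    · exact .t3 (.t4_right (.t2 h)) (hb.refutes hab)

theorem or (h : IsSentence (.or a b)) (ha : IsDecided a) (hb : IsDecided b) :
    IsDecided (.or a b) where
  proves hab := by
    rcases hab with hab | hab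
    · exact .t3 (ha.proves hab) (.t5_left (.t2 h))
    · exact .t3 (hb.proves hab) (.t5_right (.t2 h))
  refutes hab := .t5 (ha.refutes fun h => hab (.inl h)) (hb.refutes fun h => hab (.inr h))

theorem not (ha : IsDecided a) : IsDecided (.not a) where
  proves h := (ha.refutes h).tru_not
  refutes h := (ha.proves (not_not.1 h)).not_fls

theorem all (h : IsSentence (.all .num i a))
    (ha : ∀ γ : ℕ+, IsDecided (a.subst (.num, i) (.num γ))) : IsDecided (.all .num i a) where
  proves h_true := .all h fun γ => (ha γ).proves (IsTrue.all_iff.1 h_true γ)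
  refutes h_false := by
    rw [IsTrue.all_iff] at h_false
    obtain ⟨γ, hγ⟩ := not_forall.1 h_false
    exact .t3 (.all_conv γ (.t2 h)) ((ha γ).refutes hγ)

theorem ex (h : IsSentence (.ex .num i a))
    (ha : ∀ γ : ℕ+, IsDecided (a.subst (.num, i) (.num γ))) : IsDecided (.ex .num i a) where
  proves h_true := by
    obtain ⟨γ, hγ⟩ := IsTrue.ex_iff.1 h_true
    exact .t3 ((ha γ).proves hγ) (.ex_conv γ (.t2 h))
  refutes h_false := .ex h fun γ => (ha γ).refutes fun hγ => h_false (IsTrue.ex_iff.2 ⟨γ, hγ⟩)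

end IsDecided

theorem IsSentence.isDecided {a : Form N} (ha : IsSentence a) : IsDecided a :=
  ha.induction .toForm (fun _ _ => .and) (fun _ _ => .or) (fun _ _ => .not) (fun _ _ => .all)
    fun _ _ => .ex

theorem K0'.of_isTrue {a b : Form N} (ha : IsSentence a) (hb : IsSentence b)
    (h : IsTrue a → IsTrue b) : K0' a b := by
  by_cases h_true : IsTrue a
  · exact .t3 (.t2_tru ha) (hb.isDecided.proves (h h_true))
  · exact .t3 (ha.isDecided.refutes h_true) (.t2_fls hb)

theorem K0'.iff_isTrue {a b : Form N} (ha : IsSentence a) (hb : IsSentence b) :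
    K0' a b ↔ (IsTrue a → IsTrue b) :=
  ⟨fun h => h.toK0.isTrue ha hb, K0'.of_isTrue ha hb⟩

theorem K0'.iff_k0 {a b : Form N} (ha : IsSentence a) (hb : IsSentence b) : K0' a b ↔ K0 a b :=
  ⟨K0'.toK0, fun h => K0'.of_isTrue ha hb (h.isTrue ha hb)⟩

theorem Z0.iff_holds {a b : Z0Form N} : Z0 a b ↔ (a.Holds → b.Holds) := by
  refine ⟨fun h => ?_, .t1⟩
  induction h with
  | t1 h => exact h
  | t2 a => exact id
  | t2_fls a => exact False.elim
  | t2_tru a => exact fun _ => trivial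
  | t3 _ _ ih ih' => exact ih' ∘ ih

theorem Z0.iff_k0' {a b : Z0Form N} : Z0 a b ↔ K0' a.toForm b.toForm := by
  rw [Z0.iff_holds, K0'.iff_isTrue (.toForm a) (.toForm b), IsTrue.toForm_iff, IsTrue.toForm_iff]

/-! ### Minimal lattices over a two-valued preordered set -/

/-- The preorder `r` identifies the elements with the same truth value `t a`, and places the false
ones below the true ones; both truth values occur. -/
structure TwoValued {M : Type*} (r : M → M → Prop) (t : M → Prop) : Prop where
  rel_iff : ∀ a b, r a b ↔ (t a → t b)
  surjective : Function.Surjective t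

namespace TwoValued

section Relation

variable {M : Type*} {r : M → M → Prop} {p : M → Prop} {a : M}

theorem exists_iff (hr : TwoValued r p) (q : Prop) : ∃ a, p a ↔ q :=
  (hr.surjective q).imp fun _ => iff_of_eq

theorem forall_rel_left_iff (hr : TwoValued r p) : (∀ b, r a b) ↔ ¬ p a := by
  simp only [hr.rel_iff, ← hr.surjective.forall (p := fun q => p a → q)]
  exact ⟨fun h => h False, fun h _ ha => (h ha).elim⟩

theorem forall_rel_right_iff (hr : TwoValued r p) : (∀ b, r b a) ↔ p a := by
  simp only [hr.rel_iff, ← hr.surjective.forall (p := fun q => q → p a)]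
  exact ⟨fun h => h True trivial, fun h _ _ => h⟩

end Relation

section Lattice

variable {V : Type*} [Preorder V] {t : V → Prop} {s : Set V} {c d : V}

theorem isBot_iff (ht : TwoValued (· ≤ ·) t) : IsBot c ↔ ¬ t c := ht.forall_rel_left_iff

theorem isTop_iff (ht : TwoValued (· ≤ ·) t) : IsTop c ↔ t c := ht.forall_rel_right_iff

theorem isGLB_iff (ht : TwoValued (· ≤ ·) t) : IsGLB s c ↔ (t c ↔ ∀ a ∈ s, t a) := by
  simp only [isGLB_iff_le_iff, mem_lowerBounds, ht.rel_iff,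
    ← ht.surjective.forall (p := fun q => (q → t c) ↔ ∀ a ∈ s, q → t a)]
  exact ⟨fun h => by simpa only [true_imp_iff] using h True, fun h q => by rw [h]; tauto⟩

theorem isLUB_iff (ht : TwoValued (· ≤ ·) t) : IsLUB s c ↔ (t c ↔ ∃ a ∈ s, t a) := by
  simp only [isLUB_iff_le_iff, mem_upperBounds, ht.rel_iff,
    ← ht.surjective.forall (p := fun q => (t c → q) ↔ ∀ a ∈ s, t a → q)]
  refine ⟨fun h => not_iff_not.1 ?_, fun h q => by simp only [h, forall_exists_index, and_imp]⟩
  simpa only [imp_false, not_exists, not_and] using h False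

theorem complementary_iff (ht : TwoValued (· ≤ ·) t) : Complementary c d ↔ (t d ↔ ¬ t c) := by
  simp only [Complementary, ht.isBot_iff, ht.isTop_iff, ht.rel_iff,
    ← ht.surjective.forall (p := fun q => (q → t c) → (q → t d) → ¬ q),
    ← ht.surjective.forall (p := fun q => (t c → q) → (t d → q) → q)]
  refine ⟨fun ⟨h, h'⟩ => ?_, fun h => ?_⟩
  · have := h True
    have := h' False
    tauto
  · rw [h]
    exact ⟨fun q => by tauto, fun q => by tauto⟩

theorem isCCBooleanLattice (ht : TwoValued (· ≤ ·) t) : IsCCBooleanLattice V where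
  exists_isGLB s _ := by simpa only [ht.isGLB_iff] using ht.exists_iff _
  exists_isLUB s _ := by simpa only [ht.isLUB_iff] using ht.exists_iff _
  distrib a b c m j hm hj := by
    simp only [ht.isGLB_iff, ht.isLUB_iff, Set.forall_mem_insert, Set.exists_mem_insert,
      Set.mem_singleton_iff, forall_eq, exists_eq_left] at hm hj
    simp only [ht.rel_iff, hm, hj]
    tauto
  exists_compl c := by simpa only [ht.complementary_iff] using ht.exists_iff _

variable {M : Type*} {r : M → M → Prop} {p : M → Prop} {ι : M → V}

theorem isPart (ht : TwoValued (· ≤ ·) t) (hr : TwoValued r p) (hι : ∀ a, t (ι a) ↔ p a) :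
    IsPart r ι where
  le_iff a b := by rw [hr.rel_iff, ht.rel_iff, hι, hι]
  isBot z hz := by rwa [ht.isBot_iff, hι, ← hr.forall_rel_left_iff]
  isTop e he := by rwa [ht.isTop_iff, hι, ← hr.forall_rel_right_iff]

theorem isMinimalOver (ht : TwoValued (· ≤ ·) t) (hr : TwoValued r p)
    (hι : ∀ a, t (ι a) ↔ p a) : IsMinimalOver r ι where
  lattice := ht.isCCBooleanLattice
  part := ht.isPart hr hι
  minimal V₀ hV₀ _ hglb _ := by
    refine Set.eq_univ_of_forall fun v => ?_
    obtain ⟨a, ha⟩ := hr.exists_iff (t v)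
    have isGLB_singleton : IsGLB {ι a} v := by
      simp only [ht.isGLB_iff, Set.mem_singleton_iff, forall_eq, hι, ha]
    exact hglb {ι a} v (Set.singleton_subset_iff.2 (hV₀ a)) (Set.countable_singleton _)
      isGLB_singleton

theorem exists_isHomOnto {V' : Type*} [Preorder V'] {t' : V' → Prop} {ι' : M → V'}
    (ht : TwoValued (· ≤ ·) t) (ht' : TwoValued (· ≤ ·) t') (hι : ∀ a, t (ι a) ↔ t' (ι' a)) :
    ∃ φ : V → V', IsHomOnto ι ι' φ := by
  choose φ hφ using fun v => ht'.exists_iff (t v)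
  refine ⟨φ, ?_, ?_, ?_, ?_, ?_, ?_⟩
  · intro a b; rw [ht.rel_iff, ht'.rel_iff, hφ, hφ]; exact id
  · intro a b; rw [ht.complementary_iff, ht'.complementary_iff, hφ, hφ]; exact id
  · intro s c _; simp only [ht.isGLB_iff, ht'.isGLB_iff, Set.forall_mem_image, hφ]; exact id
  · intro s c _; simp only [ht.isLUB_iff, ht'.isLUB_iff, Set.exists_mem_image, hφ]; exact id
  · intro a; simp only [ht'.rel_iff, hφ, hι, imp_self, and_self]
  · intro v'
    obtain ⟨v, hv⟩ := ht.exists_iff (t' v')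
    exact ⟨v, by simp only [ht'.rel_iff, hφ, hv, imp_self, and_self]⟩

end Lattice

theorem uliftProp : TwoValued (· ≤ ·) (ULift.down : ULift.{u} Prop → Prop) where
  rel_iff _ _ := Iff.rfl
  surjective := ULift.down_surjective

end TwoValued

section IsBotOrIsTop

variable {V : Type*} [Preorder V] {s : Set V} {c d : V}

theorem Complementary.isBot_or_isTop (h : Complementary c d) (hc : IsBot c ∨ IsTop c) :
    IsBot d ∨ IsTop d :=
  hc.symm.imp (fun hc => h.1 d (hc d) le_rfl) fun hc => h.2 d (hc d) le_rfl

theorem isBot_or_isTop_of_isGLB (hs : ∀ a ∈ s, IsBot a ∨ IsTop a) (hc : IsGLB s c) :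
    IsBot c ∨ IsTop c := by
  by_cases h : ∃ a ∈ s, IsBot a
  · obtain ⟨a, has, ha⟩ := h
    exact .inl (ha.mono (hc.1 has))
  · have isTop_of_mem (a : V) (has : a ∈ s) : IsTop a :=
      (hs a has).resolve_left fun ha => h ⟨a, has, ha⟩
    exact .inr fun b => hc.2 fun a has => isTop_of_mem a has b

theorem isBot_or_isTop_of_isLUB (hs : ∀ a ∈ s, IsBot a ∨ IsTop a) (hc : IsLUB s c) :
    IsBot c ∨ IsTop c :=
  (isBot_or_isTop_of_isGLB (V := Vᵒᵈ) (fun a ha => (hs a ha).symm) hc).symm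

end IsBotOrIsTop

namespace IsMinimalOver

variable {M V : Type*} [Preorder V] {r : M → M → Prop} {p : M → Prop} {ι : M → V}

theorem isBot_or_isTop (h : IsMinimalOver r ι) (hr : TwoValued r p) (v : V) :
    IsBot v ∨ IsTop v := by
  have extremal_eq_univ : {v : V | IsBot v ∨ IsTop v} = Set.univ := by
    refine h.minimal _ (fun a => ?_) (fun a c ha hc => hc.isBot_or_isTop ha)
      (fun s c hs _ hc => isBot_or_isTop_of_isGLB hs hc)
      (fun s c hs _ hc => isBot_or_isTop_of_isLUB hs hc)
    by_cases ha : p a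
    · exact .inr (h.part.isTop a (hr.forall_rel_right_iff.2 ha))
    · exact .inl (h.part.isBot a (hr.forall_rel_left_iff.2 ha))
  exact extremal_eq_univ.ge (Set.mem_univ v)

theorem isTop_iff (h : IsMinimalOver r ι) (hr : TwoValued r p) {a : M} : IsTop (ι a) ↔ p a := by
  refine ⟨fun ha => hr.forall_rel_right_iff.1 fun b => (h.part.le_iff b a).2 (ha _), fun ha => ?_⟩
  exact h.part.isTop a (hr.forall_rel_right_iff.2 ha)

theorem twoValued (h : IsMinimalOver r ι) (hr : TwoValued r p) :
    TwoValued (· ≤ ·) (IsTop : V → Prop) where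
  rel_iff a b := by
    refine ⟨fun hab ha => ha.mono hab, fun hab => ?_⟩
    rcases h.isBot_or_isTop hr a with ha | ha
    · exact ha b
    · exact hab ha a
  surjective q := (hr.exists_iff q).elim fun a ha => ⟨ι a, propext ((h.isTop_iff hr).trans ha)⟩

end IsMinimalOver

theorem IsMinimalOver.isFreeOver {M : Type} {V : Type u} [Preorder V] {r : M → M → Prop}
    {p : M → Prop} {ι : M → V} (h : IsMinimalOver r ι) (hr : TwoValued r p) : IsFreeOver r ι where
  minimalOver := h
  hom _ _ _ h' := (h.twoValued hr).exists_isHomOnto (h'.twoValued hr) fun _ =>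
    (h.isTop_iff hr).trans (h'.isTop_iff hr).symm

theorem TwoValued.exists_isFreeOver {M : Type} {r : M → M → Prop} {p : M → Prop}
    (hr : TwoValued r p) :
    ∃ (V : Type u) (_ : Preorder V) (ι : M → V), IsFreeOver r ι :=
  ⟨ULift Prop, inferInstance, fun a => ⟨p a⟩,
    (TwoValued.uliftProp.isMinimalOver hr fun _ => Iff.rfl).isFreeOver hr⟩

/-! ### The embedding of `K₀'` -/

theorem Z0.twoValued : TwoValued (Z0 (N := N)) Z0Form.Holds where
  rel_iff _ _ := Z0.iff_holds
  surjective q := by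
    by_cases hq : q
    · exact ⟨.tru, (eq_true hq).symm⟩
    · exact ⟨.fls, (eq_false hq).symm⟩

theorem TwoValued.exists_isIsoInto {V : Type*} [Preorder V] {t : V → Prop} {ι : Z0Form N → V}
    (ht : TwoValued (· ≤ ·) t) (hι : ∀ a, t (ι a) ↔ a.Holds) :
    ∃ f : Form N → V, IsIsoInto ι f := by
  choose f hf using fun a : Form N => ht.exists_iff (IsTrue a)
  refine ⟨f, ?_, ?_, ?_, ?_, ?_, ?_, ?_⟩
  · intro a b ha hb; rw [K0'.iff_isTrue ha hb, ht.rel_iff, hf, hf]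
  · intro a; simp only [ht.rel_iff, hf, hι, IsTrue.toForm_iff, imp_self, and_self]
  · intro a b _ _
    simp only [ht.isGLB_iff, Set.forall_mem_insert, Set.mem_singleton_iff, forall_eq, hf,
      IsTrue.and_iff]
  · intro a b _ _
    simp only [ht.isLUB_iff, Set.exists_mem_insert, Set.mem_singleton_iff, exists_eq_left, hf,
      IsTrue.or_iff]
  · intro a _; rw [ht.complementary_iff, hf, hf, IsTrue.not_iff]
  · intro i b _; simp only [ht.isGLB_iff, Set.forall_mem_range, hf, IsTrue.all_iff]
  · intro i b _; simp only [ht.isLUB_iff, Set.exists_range_iff, hf, IsTrue.ex_iff]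

end Ramified

open Ramified in
theorem mainTheorem10_general (N : NumRel) :
    ¬ Z0 (N := N) .tru .fls ∧
    (∀ a b : Form N, IsSentence a → IsSentence b → (K0' a b ↔ K0 a b)) ∧
    (∀ a b : Z0Form N, Z0 a b ↔ K0' a.toForm b.toForm) ∧
    (∃ (V : Type u) (_ : Preorder V) (ι : Z0Form N → V), IsFreeOver Z0 ι) ∧
    (∀ (V : Type u) [Preorder V] (ι : Z0Form N → V), IsMinimalOver Z0 ι →
      IsFreeOver Z0 ι ∧ ∃ f : Form N → V, IsIsoInto ι f) ∧
    ¬ K0' (N := N) .tru .fls ∧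
    ∀ (T : Set Ty) (F : Form N → Prop), ¬ Thm T F .tru .fls :=
  ⟨fun h => Z0.iff_holds.1 h trivial,
    fun _ _ => K0'.iff_k0,
    fun _ _ => Z0.iff_k0',
    Z0.twoValued.exists_isFreeOver,
    fun _ _ _ h => ⟨h.isFreeOver Z0.twoValued,
      (h.twoValued Z0.twoValued).exists_isIsoInto fun _ => h.isTop_iff Z0.twoValued⟩,
    fun h => Thm.consistent _ _ h.toK0,
    Thm.consistent⟩

theorem mainTheorem10 (N : Ramified.NumRel) :
    -- `Z₀` is consistent
    ¬ Ramified.Z0 (N := N) .tru .fls ∧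
    -- `K₀'` is the part of `K₀` without free variables, and contains `Z₀` as a part
    (∀ a b : Ramified.Form N, Ramified.IsSentence a → Ramified.IsSentence b →
      (Ramified.K0' a b ↔ Ramified.K0 a b)) ∧
    (∀ a b : Ramified.Z0Form N, Ramified.Z0 a b ↔ Ramified.K0' a.toForm b.toForm) ∧
    -- the free countably complete boolean lattice over `Z₀` exists
    (∃ (V : Type u) (_ : Preorder V) (ι : Ramified.Z0Form N → V),
      Ramified.IsFreeOver Ramified.Z0 ι) ∧
    -- `K₀'` is contained isomorphically in it
    (∀ (V : Type u) [Preorder V] (ι : Ramified.Z0Form N → V),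
      Ramified.IsFreeOver Ramified.Z0 ι → ∃ f : Ramified.Form N → V, Ramified.IsIsoInto ι f) ∧
    -- `K₀'` and `K₀` are consistent
    ¬ Ramified.K0' (N := N) .tru .fls ∧
    ¬ Ramified.K0 (N := N) .tru .fls ∧
    -- over each system of ramified types, all steps of the iterated extension are consistent, and
    -- so is the ramified type logic that comprises all of them
    ∀ S : Set Ramified.Ty, Ramified.IsTypeSystem S →
      (∀ n : ℕ, ¬ Ramified.ZStage (N := N) S n .tru .fls ∧
        ¬ Ramified.KStage (N := N) S (n + 1) .tru .fls) ∧
      ¬ Ramified.K (N := N) S .tru .fls := by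
  obtain ⟨hZ0, hK0', hZ0K0', hfree, hminimal, hK0'_cons, hcons⟩ := mainTheorem10_general N
  exact ⟨hZ0, hK0', hZ0K0', hfree, fun V _ ι h => (hminimal V ι h.minimalOver).2, hK0'_cons,
    hcons _ _, fun S _ => ⟨fun n => ⟨hcons _ _, hcons _ _⟩, hcons _ _⟩⟩
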